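/- **Setting.** Let $G=(V,E,w)$ be a finite connected graph with symmetric edge weights $w_{ij}>0$ for $\{i,j\}\in E$, let $E'=\{(i,j),(j,i):\{i,j\}\in E\}$ be its oriented edges, and let $\mu\ne\nu$ be probability vectors on $V$. Let $p\in[1,\infty]$. Let $B\in\mathbb R^{V\times E'}$ be the oriented incidence matrix, so that $(B^\top\phi)_{(i,j)}=\phi_i-\phi_j$. For $u\in\mathbb R^{E'}$ let $s(u)=\sum_{\{i,j\}\in E}w_{ij}\tfrac12\big(|u_{(i,j)}|^p+|u_{(j,i)}|^p\big)$ if $p<\infty$, and $s(u)=\max_{(i,j)\in E'}w_{ij}|u_{(i,j)}|$ if $p=\infty$. The primal problem is $$\text{(Pr)}\qquad \min_{\phi\in\mathbb R^V,\;u\in\mathbb R^{E'}} s(u)\quad\text{s.t.}\quad \phi^\top(\mu-\nu)=1,\quad B^\top\phi-u=0 .$$ Feasibility and the objective do not change when a constant is added to $\phi$, so potentials are considered modulo constants, through their mean-centered representatives $\hat\phi=\phi-\big(\tfrac1{|V|}\sum_i\phi_i\big)\mathbf 1$. Let $S$ be the set of mean-centered $\phi$ for which $(\phi,B^\top\phi)$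 is optimal for (Pr). **Algorithm (SSNAL).** For $\sigma_1,\sigma_2>0$ let $$\mathcal L_\sigma(\phi,u;y,z)=s(u)+y\,(\phi^\top(\mu-\nu)-1)+\langle z,B^\top\phi-u\rangle+\tfrac{\sigma_1}{2}\|B^\top\phi-u\|^2+\tfrac{\sigma_2}{2}|\phi^\top(\mu-\nu)-1|^2 .$$ Let $(\sigma_1)_k,(\sigma_2)_k>0$ be nondecreasing sequences of penalty parameters (bounded or not), put $\sigma_k=\min\{(\sigma_1)_k,(\sigma_2)_k\}$, and let $\epsilon_k\ge0$ with $\sum_k\epsilon_k<\infty$. Let $(\phi_k,u_k,z_k,y_k)_{k\ge0}$ be any sequence, with arbitrary initial values, such that for every $k$, with $F_k(\phi,u)=\mathcal L_{((\sigma_1)_k,(\sigma_2)_k)}(\phi,u;y_k,z_k)$ and with $\partial$ the convex subdifferential, $$\operatorname{dist}\big(0,\partial F_k(\phi_{k+1},u_{k+1})\big)\le \frac{\epsilon_k}{\max\{1,\sqrt{\sigma_k}\}},$$ $$z_{k+1}=z_k+(\sigma_1)_k(B^\top\phi_{k+1}-u_{k+1}),\qquad y_{k+1}=y_k+(\sigma_2)_k(\phi_{k+1}^\top(\mu-\nu)-1).$$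 **Theorem (Convergence of SSNAL).** 1. The sequence $(\hat\phi_k)$ is bounded, $S$ is nonempty, and $\operatorname{dist}(\hat\phi_k,S)\to0$. 2. If $1<p<\infty$, then (Pr) has a unique mean-centered optimal solution $\phi^*$, i.e. $S=\{\phi^*\}$, and $\hat\phi_k\to\phi^*$. For every $p\in[1,\infty]$ the same convergence holds whenever $S=\{\phi^*\}$ is a single point. 3. $\|B^\top\phi_k-u_k\|\to0$ and $|\phi_k^\top(\mu-\nu)-1|\to0$. -/

import Mathlib

open Filter Topology
open scoped ENNReal

noncomputable section

namespace PConductance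

variable {V : Type*} [Fintype V] [DecidableEq V]

/-- The convex subdifferential of a real function on a real inner product space. -/
def subdifferential {X : Type*} [NormedAddCommGroup X] [InnerProductSpace ℝ X]
    (f : X → ℝ) (x : X) : Set X :=
  {g | ∀ x' : X, f x + inner ℝ g (x' - x) ≤ f x'}

/-- The oriented incidence matrix. The columns are the oriented edges `(i, j)` and `(j, i)` for
`{i, j}` an edge; column `(i, j)` has entry `1` at `i` and `-1` at `j`. -/
def incidence (G : SimpleGraph V) : Matrix V G.Dart ℝ :=
  fun i d => (if i = d.fst then 1 else 0) - (if i = d.snd then 1 else 0)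

/-- The graph gradient `Bᵀ φ`, with entries `φ i - φ j` at the oriented edge `(i, j)`. -/
def grad (G : SimpleGraph V) [DecidableRel G.Adj] (φ : EuclideanSpace ℝ V) :
    EuclideanSpace ℝ G.Dart :=
  WithLp.toLp 2 ((incidence G).transpose.mulVec (WithLp.ofLp φ))

/-- The objective `s`. For finite `p` it is the sum of `w i j * |u i j| ^ p` over the unordered
edges, each edge being the mean of its two orientations (which agree when `u = Bᵀ φ`), and for
`p = ∞` it is the maximum of `w i j * |u i j|`. -/
def energy (G : SimpleGraph V) [DecidableRel G.Adj] (w : V → V → ℝ) (p : ℝ≥0∞)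
    (u : EuclideanSpace ℝ G.Dart) : ℝ :=
  if p = ⊤ then ⨆ d : G.Dart, w d.fst d.snd * |u d|
  else (1 / 2) * ∑ d : G.Dart, w d.fst d.snd * |u d| ^ p.toReal

/-- The pairing `φᵀ (μ - ν)`. -/
def pairing (μ ν : V → ℝ) (φ : EuclideanSpace ℝ V) : ℝ :=
  ∑ i, φ i * (μ i - ν i)

/-- Feasibility for the primal problem
`min s(u)` subject to `φᵀ (μ - ν) = 1` and `Bᵀ φ - u = 0`. -/
def IsFeasible (G : SimpleGraph V) [DecidableRel G.Adj] (μ ν : V → ℝ)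
    (φ : EuclideanSpace ℝ V) (u : EuclideanSpace ℝ G.Dart) : Prop :=
  pairing μ ν φ = 1 ∧ grad G φ - u = 0

/-- `(φ, u)` is an optimal solution of the primal problem. -/
def IsOptimal (G : SimpleGraph V) [DecidableRel G.Adj] (w : V → V → ℝ) (p : ℝ≥0∞)
    (μ ν : V → ℝ) (φ : EuclideanSpace ℝ V) (u : EuclideanSpace ℝ G.Dart) : Prop :=
  IsFeasible G μ ν φ u ∧
    ∀ φ' u', IsFeasible G μ ν φ' u' → energy G w p u ≤ energy G w p u'

/-- The mean-centered potentials `φ` that are (with a suitable `u`) optimal for the primal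
problem. -/
def centeredSolutions (G : SimpleGraph V) [DecidableRel G.Adj] (w : V → V → ℝ) (p : ℝ≥0∞)
    (μ ν : V → ℝ) : Set (EuclideanSpace ℝ V) :=
  {φ | ∑ i, φ i = 0 ∧ ∃ u, IsOptimal G w p μ ν φ u}

/-- The mean-centered representative of a potential modulo constants. -/
def center (φ : EuclideanSpace ℝ V) : EuclideanSpace ℝ V :=
  WithLp.toLp 2 fun i => φ i - (∑ j, φ j) / (Fintype.card V : ℝ)

/-- The augmented Lagrangian, as a function of the pair `x = (φ, u)` in the Euclidean space
`ℝ^V × ℝ^E'`. -/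
def augLagrangian (G : SimpleGraph V) [DecidableRel G.Adj] (w : V → V → ℝ) (p : ℝ≥0∞)
    (μ ν : V → ℝ) (σ₁ σ₂ : ℝ) (y : ℝ) (z : EuclideanSpace ℝ G.Dart)
    (x : WithLp 2 (EuclideanSpace ℝ V × EuclideanSpace ℝ G.Dart)) : ℝ :=
  energy G w p x.snd
    + y * (pairing μ ν x.fst - 1)
    + inner ℝ z (grad G x.fst - x.snd)
    + σ₁ / 2 * ‖grad G x.fst - x.snd‖ ^ 2
    + σ₂ / 2 * |pairing μ ν x.fst - 1| ^ 2

/-- The sequences are generated by the inexact augmented Lagrangian method with penalties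
`σ₁ k, σ₂ k`: each `(φ (k+1), u (k+1))` minimizes the augmented Lagrangian at the multipliers
`y k, z k` up to the tolerance
`dist (0, ∂F_k (φ (k+1), u (k+1))) ≤ ε k / max {1, √(σ k)}`, where `σ k = min (σ₁ k) (σ₂ k)`,
and the multipliers are then updated. -/
structure IsSSNALSequence (G : SimpleGraph V) [DecidableRel G.Adj] (w : V → V → ℝ) (p : ℝ≥0∞)
    (μ ν : V → ℝ) (σ₁ σ₂ ε : ℕ → ℝ)
    (φ : ℕ → EuclideanSpace ℝ V) (u z : ℕ → EuclideanSpace ℝ G.Dart) (y : ℕ → ℝ) : Prop where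
  stopping : ∀ k,
    Metric.infEDist 0
        (subdifferential (augLagrangian G w p μ ν (σ₁ k) (σ₂ k) (y k) (z k))
          (WithLp.toLp 2 (φ (k + 1), u (k + 1))))
      ≤ ENNReal.ofReal (ε k / max 1 (Real.sqrt (min (σ₁ k) (σ₂ k))))
  z_update : ∀ k, z (k + 1) = z k + σ₁ k • (grad G (φ (k + 1)) - u (k + 1))
  y_update : ∀ k, y (k + 1) = y k + σ₂ k * (pairing μ ν (φ (k + 1)) - 1)

end PConductance

end

/-!
The augmented Lagrangian method is an inexact proximal-point method on the dual problem, and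
convergence follows from a Lyapunov argument in the multipliers. A subgradient of the augmented
Lagrangian at `(φ, u)` is a subgradient of the ordinary Lagrangian at the updated multipliers
(`add_inner_le_of_mem_subdifferential`). Tested against an optimal potential, this bounds the excess
of the objective by the residuals paired with the new multipliers, plus an error proportional to the
tolerance (`energy_add_inner_le_of_stationary`). An optimal multiplier, from Hahn-Banach separation
(`exists_multiplier`), gives the matching lower bound.

Let `D k` be the squared distance from the multipliers to an optimal one, in the metric scaled by the
inverse penalties, and `R k` the squared residuals weighted by the penalties. Since the penalties are
nondecreasing, `D (k + 1) ≤ D k - R k + 2 ε k Q k`, where `Q k` is linear in `‖u (k + 1)‖` and in the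
residual. The inner problems are not strongly convex, so `Q k` has to be controlled otherwise: the
objective grows at least linearly (`exists_linear_growth_energy`) and its value at `u (k + 1)` is at
most a constant plus `D k` plus `ε k Q k`, hence `Q k` is at most a multiple of `1 + D k` plus a
multiple of `R k` once `ε k` is small. A discrete Gronwall inequality
(`bounded_and_tendsto_of_le_one_add_mul_sub`) then bounds `D` and makes `R` tend to zero
(`multiplier_method_estimates`). The residuals thus tend to zero, `u` is bounded, and the
upper limit of the objective is at most the optimal value.

The Poincaré inequality on the connected graph (`exists_norm_center_le`) transfers boundedness to the
centered potentials. Every limit of a subsequence is feasible and optimal, so compactness gives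
convergence to the set of solutions. For `1 < p < ∞` this set is a single point by strict convexity.
-/

namespace PConductance

/-! ### Estimates for the method of multipliers -/

/-- A discrete Gronwall inequality with a dissipation term: multiplicative perturbations of
summable size keep `b` bounded, and telescoping then makes the dissipated amounts `R` summable. -/
theorem bounded_and_tendsto_of_le_one_add_mul_sub {b a R : ℕ → ℝ} (hb : ∀ k, 0 ≤ b k)
    (ha : ∀ k, 0 ≤ a k) (hR : ∀ k, 0 ≤ R k) (hsum : Summable a)
    (h : ∀ᶠ k in atTop, b (k + 1) ≤ (1 + a k) * b k - R k) :
    (∃ M, ∀ᶠ k in atTop, b k ≤ M) ∧ Tendsto R atTop (𝓝 0) := by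
  obtain ⟨K, hK⟩ := eventually_atTop.1 h
  have hsum' : Summable fun k => a (k + K) := (summable_nat_add_iff K).2 hsum
  have hstep : ∀ k, b (k + 1 + K) ≤ (1 + a (k + K)) * b (k + K) - R (k + K) := fun k => by
    have := hK (k + K) (Nat.le_add_left _ _)
    rwa [Nat.add_right_comm] at this
  have hpart : ∀ n, ∑ i ∈ Finset.range n, a (i + K) ≤ ∑' i, a (i + K) := fun n =>
    hsum'.sum_le_tsum _ fun i _ => ha _
  have hexp : ∀ n, b (n + K) ≤ b K * Real.exp (∑ i ∈ Finset.range n, a (i + K)) := by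
    intro n
    induction n with
    | zero => simp
    | succ n ih =>
      have h1 : 1 + a (n + K) ≤ Real.exp (a (n + K)) := by
        linarith [Real.add_one_le_exp (a (n + K))]
      calc b (n + 1 + K) ≤ (1 + a (n + K)) * b (n + K) := by linarith [hstep n, hR (n + K)]
        _ ≤ Real.exp (a (n + K)) * (b K * Real.exp (∑ i ∈ Finset.range n, a (i + K))) :=
            mul_le_mul h1 ih (hb _) (Real.exp_pos _).le
        _ = _ := by rw [Finset.sum_range_succ, Real.exp_add]; ring
  set M := b K * Real.exp (∑' i, a (i + K)) with hM
  have hbM : ∀ n, b (n + K) ≤ M := fun n => (hexp n).trans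
    (mul_le_mul_of_nonneg_left (Real.exp_le_exp.2 (hpart n)) (hb K))
  have hM0 : 0 ≤ M := (hb _).trans (hbM 0)
  refine ⟨⟨M, eventually_atTop.2 ⟨K, fun k hk => ?_⟩⟩, ?_⟩
  · simpa [Nat.sub_add_cancel hk] using hbM (k - K)
  · have hRsum : ∀ n, ∑ i ∈ Finset.range n, R (i + K)
        ≤ b K - b (n + K) + M * ∑ i ∈ Finset.range n, a (i + K) := by
      intro n
      induction n with
      | zero => simp
      | succ n ih =>
        rw [Finset.sum_range_succ, Finset.sum_range_succ]
        have := mul_le_mul_of_nonneg_left (hbM n) (ha (n + K))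
        nlinarith [hstep n]
    have : Summable fun k => R (k + K) :=
      summable_of_sum_range_le (c := b K + M * ∑' i, a (i + K)) (fun _ => hR _) fun n => by
        have := mul_le_mul_of_nonneg_left (hpart n) hM0
        linarith [hRsum n, hb (n + K)]
    exact (tendsto_add_atTop_iff_nat K).1 this.tendsto_atTop_zero

section Multipliers

variable {U : Type*} [NormedAddCommGroup U] [InnerProductSpace ℝ U]

/-- The proximal-point (three-point) identity for a multiplier update `z ↦ z + σ r`, in the metric
scaled by `1 / σ`. -/
theorem norm_sq_multiplier_update (z zo r : U) {σ : ℝ} (hσ : 0 < σ) :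
    ‖z + σ • r - zo‖ ^ 2 / σ
      = ‖z - zo‖ ^ 2 / σ + 2 * inner ℝ (z + σ • r - zo) r - σ * ‖r‖ ^ 2 := by
  have h1 : z + σ • r - zo = (z - zo) + σ • r := by abel
  rw [h1, norm_add_sq_real, inner_add_left, real_inner_smul_left, real_inner_smul_right,
    norm_smul, real_inner_self_eq_norm_sq, Real.norm_of_nonneg hσ.le]
  field_simp
  ring

theorem sq_multiplier_update (y yo ρ : ℝ) {σ : ℝ} (hσ : 0 < σ) :
    (y + σ * ρ - yo) ^ 2 / σ = (y - yo) ^ 2 / σ + 2 * ((y + σ * ρ - yo) * ρ) - σ * ρ ^ 2 := by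
  field_simp
  ring

/-- The dual estimates of the inexact method of multipliers. The sequences `r` and `ρ` are the two
primal residuals and `f` the objective values, while `fo` is the optimal value, attained at `uo`,
and `(zo, yo)` is an optimal multiplier. The inexact minimization enters only through `hprimal`,
the saddle-point property of `(zo, yo)` through `hdual`, and coercivity of the objective through
`hgrowth`. The Lyapunov function is the squared distance of `(z k, y k)` to `(zo, yo)` in the
metric scaled by `1 / σ₁ k` and `1 / σ₂ k`; it is the monotonicity of the penalties that makes
these changing metrics comparable. The multipliers themselves need not be bounded.

The terms `u k`, `r k`, `ρ k`, `f k` belong to the step leading from `(z k, y k)` to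
`(z (k + 1), y (k + 1))`. -/
theorem multiplier_method_estimates {u z r : ℕ → U} {y ρ f σ₁ σ₂ ε : ℕ → ℝ}
    {uo zo : U} {yo fo κ c C : ℝ} (hκ : 0 ≤ κ) (hc : 0 < c)
    (hσ₁_pos : ∀ k, 0 < σ₁ k) (hσ₁_mono : Monotone σ₁)
    (hσ₂_pos : ∀ k, 0 < σ₂ k) (hσ₂_mono : Monotone σ₂)
    (hε_nonneg : ∀ k, 0 ≤ ε k) (hε_sum : Summable ε)
    (hz : ∀ k, z (k + 1) = z k + σ₁ k • r k) (hy : ∀ k, y (k + 1) = y k + σ₂ k * ρ k)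
    (hprimal : ∀ k, f k + inner ℝ (z (k + 1)) (r k) + y (k + 1) * ρ k
      ≤ fo + ε k * ((1 + κ) * ‖u k - uo‖ + κ * ‖r k‖))
    (hdual : ∀ k, fo ≤ f k + inner ℝ zo (r k) + yo * ρ k)
    (hgrowth : ∀ k, c * ‖u k‖ - C ≤ f k) :
    (∃ M, ∀ᶠ k in atTop, ‖u k‖ ≤ M) ∧ Tendsto r atTop (𝓝 0) ∧ Tendsto ρ atTop (𝓝 0) ∧
      ∃ e : ℕ → ℝ, Tendsto e atTop (𝓝 0) ∧ ∀ᶠ k in atTop, f k ≤ fo + e k := by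
  set D : ℕ → ℝ := fun k => ‖z k - zo‖ ^ 2 / σ₁ k + (y k - yo) ^ 2 / σ₂ k with hD
  set N : ℕ → ℝ := fun k => ‖z k‖ ^ 2 / σ₁ k + y k ^ 2 / σ₂ k with hN
  set R : ℕ → ℝ := fun k => σ₁ k * ‖r k‖ ^ 2 + σ₂ k * ρ k ^ 2 with hR
  set Q : ℕ → ℝ := fun k => (1 + κ) * ‖u k - uo‖ + κ * ‖r k‖ with hQ
  set C₀ : ℝ := 2 * (‖zo‖ ^ 2 / σ₁ 0 + yo ^ 2 / σ₂ 0) with hC₀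
  have hσ₁0 := hσ₁_pos 0
  have hσ₂0 := hσ₂_pos 0
  have hD0 : ∀ k, 0 ≤ D k := fun k => by
    have := hσ₁_pos k; have := hσ₂_pos k; simp only [hD]; positivity
  have hR0 : ∀ k, 0 ≤ R k := fun k => by
    have := hσ₁_pos k; have := hσ₂_pos k; simp only [hR]; positivity
  have hC₀0 : 0 ≤ C₀ := by positivity
  have hrR : ∀ k, σ₁ 0 * ‖r k‖ ^ 2 ≤ R k := fun k => by
    have h1 := mul_le_mul_of_nonneg_right (hσ₁_mono (Nat.zero_le k)) (sq_nonneg ‖r k‖)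
    have h2 := mul_nonneg (hσ₂_pos k).le (sq_nonneg (ρ k))
    simp only [hR]; linarith
  have hρR : ∀ k, σ₂ 0 * ρ k ^ 2 ≤ R k := fun k => by
    have h1 := mul_le_mul_of_nonneg_right (hσ₂_mono (Nat.zero_le k)) (sq_nonneg (ρ k))
    have h2 := mul_nonneg (hσ₁_pos k).le (sq_nonneg ‖r k‖)
    simp only [hR]; linarith
  -- The Lyapunov function decreases by `R`, up to the inexactness: `hprimal` and `hdual` add up to
  -- a bound on the cross term of the three-point identities.
  have hDstep : ∀ k, D (k + 1) ≤ D k + 2 * (ε k * Q k) - R k := by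
    intro k
    have h1 : ‖z (k + 1) - zo‖ ^ 2 / σ₁ (k + 1) ≤ ‖z (k + 1) - zo‖ ^ 2 / σ₁ k :=
      div_le_div_of_nonneg_left (sq_nonneg _) (hσ₁_pos k) (hσ₁_mono k.le_succ)
    have h2 : (y (k + 1) - yo) ^ 2 / σ₂ (k + 1) ≤ (y (k + 1) - yo) ^ 2 / σ₂ k :=
      div_le_div_of_nonneg_left (sq_nonneg _) (hσ₂_pos k) (hσ₂_mono k.le_succ)
    have h3 := norm_sq_multiplier_update (z k) zo (r k) (hσ₁_pos k)
    have h4 := sq_multiplier_update (y k) yo (ρ k) (hσ₂_pos k)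
    rw [← hz, inner_sub_left] at h3
    rw [← hy] at h4
    simp only [hD, hR, hQ]
    linarith [hprimal k, hdual k]
  have hND : ∀ k, N k ≤ 2 * D k + C₀ := by
    intro k
    have h1 : ‖z k‖ ^ 2 / σ₁ k ≤ 2 * (‖z k - zo‖ ^ 2 / σ₁ k) + 2 * (‖zo‖ ^ 2 / σ₁ 0) := by
      have h3 : ‖zo‖ ^ 2 / σ₁ k ≤ ‖zo‖ ^ 2 / σ₁ 0 :=
        div_le_div_of_nonneg_left (sq_nonneg _) (hσ₁_pos 0) (hσ₁_mono (Nat.zero_le k))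
      have h4 : ‖z k‖ ≤ ‖z k - zo‖ + ‖zo‖ := by simpa using norm_add_le (z k - zo) zo
      have h5 : ‖z k‖ ^ 2 ≤ 2 * ‖z k - zo‖ ^ 2 + 2 * ‖zo‖ ^ 2 := by
        nlinarith [norm_nonneg (z k), sq_nonneg (‖z k - zo‖ - ‖zo‖)]
      have h6 := div_le_div_of_nonneg_right h5 (hσ₁_pos k).le
      rw [add_div, mul_div_assoc, mul_div_assoc] at h6
      linarith
    have h2 : y k ^ 2 / σ₂ k ≤ 2 * ((y k - yo) ^ 2 / σ₂ k) + 2 * (yo ^ 2 / σ₂ 0) := by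
      have h3 : yo ^ 2 / σ₂ k ≤ yo ^ 2 / σ₂ 0 :=
        div_le_div_of_nonneg_left (sq_nonneg _) (hσ₂_pos 0) (hσ₂_mono (Nat.zero_le k))
      have h5 : y k ^ 2 ≤ 2 * (y k - yo) ^ 2 + 2 * yo ^ 2 := by
        nlinarith [sq_nonneg (y k - yo - yo)]
      have h6 := div_le_div_of_nonneg_right h5 (hσ₂_pos k).le
      rw [add_div, mul_div_assoc, mul_div_assoc] at h6
      linarith
    simp only [hN, hD, hC₀]
    linarith
  -- The three-point identity with reference point `0` bounds `-⟨z (k + 1), r k⟩`, and so the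
  -- objective, by the size of the current multipliers.
  have hf : ∀ k, f k ≤ fo + N k / 2 - R k / 2 + ε k * Q k := by
    intro k
    have h3 := norm_sq_multiplier_update (z k) 0 (r k) (hσ₁_pos k)
    have h4 := sq_multiplier_update (y k) 0 (ρ k) (hσ₂_pos k)
    rw [← hz, sub_zero, sub_zero] at h3
    rw [← hy, sub_zero, sub_zero] at h4
    have h5 : 0 ≤ ‖z (k + 1)‖ ^ 2 / σ₁ k := div_nonneg (sq_nonneg _) (hσ₁_pos k).le
    have h6 : 0 ≤ y (k + 1) ^ 2 / σ₂ k := div_nonneg (sq_nonneg _) (hσ₂_pos k).le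
    simp only [hN, hR, hQ]
    linarith [hprimal k]
  have hQle : ∀ k, Q k ≤ (1 + κ) * (‖u k‖ + ‖uo‖) + κ * (1 + R k / σ₁ 0) := by
    intro k
    have h1 : ‖r k‖ ≤ 1 + R k / σ₁ 0 := by
      have : ‖r k‖ ^ 2 ≤ R k / σ₁ 0 := (le_div_iff₀ hσ₁0).2 (by linarith [hrR k])
      nlinarith [sq_nonneg (‖r k‖ - 1), norm_nonneg (r k)]
    have h2 := norm_sub_le (u k) uo
    simp only [hQ]
    gcongr
  have hε0 : Tendsto ε atTop (𝓝 0) := hε_sum.tendsto_atTop_zero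
  -- Once `ε k` is small, the inexactness `ε k * Q k` is absorbed by the coercivity of the objective
  -- and by half of the dissipation `R k`.
  have hsmall : ∀ᶠ k in atTop, ε k * (1 + κ) ≤ c / 2 ∧ ε k * κ / σ₁ 0 ≤ 1 / 4 := by
    have h1 : Tendsto (fun k => ε k * (1 + κ)) atTop (𝓝 0) := by
      simpa using hε0.mul_const (1 + κ)
    have h2 : Tendsto (fun k => ε k * κ / σ₁ 0) atTop (𝓝 0) := by
      simpa using (hε0.mul_const κ).div_const (σ₁ 0)
    exact (h1.eventually_le_const (by positivity)).and (h2.eventually_le_const (by norm_num))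
  set B : ℝ := |C + fo + C₀ / 2 + c / 2 * ‖uo‖ + c / 2| with hB
  have hu : ∀ᶠ k in atTop, ‖u k‖ ≤ 2 / c * (B + D k) := by
    filter_upwards [hsmall] with k hk
    have h1 := mul_le_mul_of_nonneg_left (hQle k) (hε_nonneg k)
    have h2 := mul_le_mul_of_nonneg_right hk.1 (add_nonneg (norm_nonneg (u k)) (norm_nonneg uo))
    have h3 := mul_le_mul_of_nonneg_right hk.2 (hR0 k)
    have h4 : ε k * (κ * (1 + R k / σ₁ 0)) = ε k * κ + ε k * κ / σ₁ 0 * R k := by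
      field_simp
    have h5 : C + fo + C₀ / 2 + c / 2 * ‖uo‖ + c / 2 ≤ B := le_abs_self _
    have h6 : c / 2 * ‖u k‖ ≤ B + D k := by
      linarith [hf k, hgrowth k, hND k, hR0 k, hε_nonneg k]
    calc ‖u k‖ = 2 / c * (c / 2 * ‖u k‖) := by field_simp
      _ ≤ _ := by gcongr
  set C₁ : ℝ := 2 * ((1 + κ) * (2 / c * (B + 1) + ‖uo‖) + κ) with hC₁
  have hB0 : 0 ≤ B := abs_nonneg _
  have hC₁0 : 0 ≤ C₁ := by positivity
  obtain ⟨⟨M, hM⟩, hRlim⟩ := bounded_and_tendsto_of_le_one_add_mul_sub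
    (b := fun k => D k + 1) (a := fun k => C₁ * ε k) (R := fun k => R k / 2)
    (fun k => by linarith [hD0 k]) (fun k => mul_nonneg hC₁0 (hε_nonneg k))
    (fun k => by linarith [hR0 k]) (hε_sum.mul_left C₁) (by
      filter_upwards [hsmall, hu] with k hk huk
      have h1 : Q k ≤ C₁ / 2 * (D k + 1) + κ * (R k / σ₁ 0) := by
        have h2 : ‖u k‖ ≤ 2 / c * (B + 1) * (D k + 1) := by
          have : B + D k ≤ (B + 1) * (D k + 1) := by nlinarith [hD0 k]
          calc ‖u k‖ ≤ 2 / c * (B + D k) := huk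
            _ ≤ 2 / c * ((B + 1) * (D k + 1)) := by gcongr
            _ = _ := by ring
        have h3 : ‖uo‖ ≤ ‖uo‖ * (D k + 1) := by nlinarith [hD0 k, norm_nonneg uo]
        have h4 : κ ≤ κ * (D k + 1) := by nlinarith [hD0 k]
        have h5 : (1 + κ) * (‖u k‖ + ‖uo‖)
            ≤ (1 + κ) * (2 / c * (B + 1) * (D k + 1) + ‖uo‖ * (D k + 1)) := by gcongr
        have := hQle k
        rw [hC₁]
        linarith
      have h2 := mul_le_mul_of_nonneg_left h1 (hε_nonneg k)
      have h3 := mul_le_mul_of_nonneg_right hk.2 (hR0 k)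
      have h4 : ε k * (κ * (R k / σ₁ 0)) = ε k * κ / σ₁ 0 * R k := by ring
      linarith [hDstep k])
  have hRlim : Tendsto R atTop (𝓝 0) := by simpa using hRlim.mul_const 2
  have hsqrt : Tendsto (fun k => √(R k)) atTop (𝓝 0) := by simpa using hRlim.sqrt
  have hDM : ∀ᶠ k in atTop, D k ≤ M := hM.mono fun k hk => by linarith
  refine ⟨⟨2 / c * (B + M), ?_⟩, ?_, ?_, ?_⟩
  · filter_upwards [hu, hDM] with k h1 h2
    exact h1.trans (by gcongr)
  · have h1 : Tendsto (fun k => √(R k / σ₁ 0)) atTop (𝓝 0) := by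
      simpa using (hRlim.div_const (σ₁ 0)).sqrt
    refine squeeze_zero_norm (fun k => Real.le_sqrt_of_sq_le ?_) h1
    exact (le_div_iff₀ hσ₁0).2 (by linarith [hrR k])
  · have h1 : Tendsto (fun k => √(R k / σ₂ 0)) atTop (𝓝 0) := by
      simpa using (hRlim.div_const (σ₂ 0)).sqrt
    refine squeeze_zero_norm (fun k => Real.le_sqrt_of_sq_le ?_) h1
    rw [Real.norm_eq_abs, sq_abs]
    exact (le_div_iff₀ hσ₂0).2 (by linarith [hρR k])
  · refine ⟨fun k => 2 * (√(2 * M + C₀) * √(R k))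
      + ε k * ((1 + κ) * (2 / c * (B + M) + ‖uo‖) + κ * (1 + 1 / σ₁ 0)), ?_, ?_⟩
    · simpa using ((hsqrt.const_mul (√(2 * M + C₀))).const_mul 2).add
        (hε0.mul_const ((1 + κ) * (2 / c * (B + M) + ‖uo‖) + κ * (1 + 1 / σ₁ 0)))
    · filter_upwards [hu, hDM, hRlim.eventually_le_const one_pos] with k huk hDk hRk
      have hNM : N k ≤ 2 * M + C₀ := by linarith [hND k]
      have hsq : √(N k * R k) ≤ √(2 * M + C₀) * √(R k) := by
        rw [← Real.sqrt_mul' _ (hR0 k)]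
        exact Real.sqrt_le_sqrt (mul_le_mul_of_nonneg_right hNM (hR0 k))
      have h1 := hσ₁_pos k
      have h2 := hσ₂_pos k
      have hin : |inner ℝ (z k) (r k)| ≤ √(N k * R k) := by
        refine Real.abs_le_sqrt ?_
        calc inner ℝ (z k) (r k) ^ 2 ≤ (‖z k‖ * ‖r k‖) ^ 2 :=
              sq_le_sq.2 ((abs_real_inner_le_norm _ _).trans (le_abs_self _))
          _ = (‖z k‖ ^ 2 / σ₁ k) * (σ₁ k * ‖r k‖ ^ 2) := by field_simp
          _ ≤ N k * R k := by
            simp only [hN, hR]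
            gcongr
            · exact le_add_of_nonneg_right (by positivity)
            · exact le_add_of_nonneg_right (by positivity)
      have hyr : |y k * ρ k| ≤ √(N k * R k) := by
        refine Real.abs_le_sqrt ?_
        calc (y k * ρ k) ^ 2 = (y k ^ 2 / σ₂ k) * (σ₂ k * ρ k ^ 2) := by field_simp
          _ ≤ N k * R k := by
            simp only [hN, hR]
            gcongr
            · exact le_add_of_nonneg_left (by positivity)
            · exact le_add_of_nonneg_left (by positivity)
      have hQk : Q k ≤ (1 + κ) * (2 / c * (B + M) + ‖uo‖) + κ * (1 + 1 / σ₁ 0) := by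
        refine (hQle k).trans ?_
        gcongr
        exact huk.trans (by gcongr)
      have hεQ := mul_le_mul_of_nonneg_left hQk (hε_nonneg k)
      -- Writing `z (k + 1) = z k + σ₁ k r k` (and likewise for `y`) leaves the cross terms with the
      -- current multipliers, which are bounded in the scaled metric, plus `R k ≥ 0`.
      have hp := hprimal k
      rw [hz, hy, inner_add_left, real_inner_smul_left, real_inner_self_eq_norm_sq] at hp
      have hRk' : σ₁ k * ‖r k‖ ^ 2 + σ₂ k * ρ k * ρ k = R k := by simp only [hR]; ring
      have := neg_abs_le (inner ℝ (z k) (r k))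
      have := neg_abs_le (y k * ρ k)
      have hQ' : (1 + κ) * ‖u k - uo‖ + κ * ‖r k‖ = Q k := rfl
      rw [hQ'] at hp
      linarith [hR0 k]

end Multipliers

/-! ### Convex duality and subgradients of the augmented Lagrangian -/

section Convex

variable {E U : Type*} [NormedAddCommGroup E] [InnerProductSpace ℝ E]
  [NormedAddCommGroup U] [InnerProductSpace ℝ U]

/-- Comparison of first-order terms: divide by `t` and let `t` decrease to `0`. -/
theorem le_of_forall_mul_le_mul_add_sq {a b q : ℝ}
    (h : ∀ t : ℝ, 0 < t → t ≤ 1 → t * a ≤ t * b + t ^ 2 * q) : a ≤ b := by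
  have hlim : Tendsto (fun t : ℝ => b + t * q) (𝓝[>] 0) (𝓝 b) := by
    have : Tendsto (fun t : ℝ => b + t * q) (𝓝 0) (𝓝 (b + 0 * q)) :=
      (continuous_const.add (continuous_id.mul continuous_const)).tendsto 0
    simpa using this.mono_left nhdsWithin_le_nhds
  refine ge_of_tendsto hlim ?_
  filter_upwards [Ioc_mem_nhdsGT (zero_lt_one' ℝ)] with t ht
  refine le_of_mul_le_mul_left ?_ ht.1
  linarith [h t ht.1 ht.2]

/-- The sum rule for the subdifferential of a convex function plus the quadratic part of the
augmented Lagrangian: the derivative of the quadratic part at `(φ, u)` is that of the ordinary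
Lagrangian at the updated multipliers `z + σ₁ (A φ - u)` and `y + σ₂ (ℓ φ - 1)`. -/
theorem add_inner_le_of_mem_subdifferential {s : U → ℝ} (hs : ConvexOn ℝ Set.univ s)
    (A : E →ₗ[ℝ] U) (ℓ : E →ₗ[ℝ] ℝ) {σ₁ σ₂ y : ℝ} {z : U}
    {F : WithLp 2 (E × U) → ℝ}
    (hF : ∀ x, F x = s x.snd + y * (ℓ x.fst - 1) + inner ℝ z (A x.fst - x.snd)
      + σ₁ / 2 * ‖A x.fst - x.snd‖ ^ 2 + σ₂ / 2 * |ℓ x.fst - 1| ^ 2)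
    {φ : E} {u : U} {g : WithLp 2 (E × U)} (hg : g ∈ subdifferential F (WithLp.toLp 2 (φ, u)))
    (v : E) (h : U) :
    s u + inner ℝ g (WithLp.toLp 2 (v, h)) ≤ s (u + h)
      + inner ℝ (z + σ₁ • (A φ - u)) (A v - h) + (y + σ₂ * (ℓ φ - 1)) * ℓ v := by
  suffices inner ℝ g (WithLp.toLp 2 (v, h)) ≤ (s (u + h) - s u)
      + inner ℝ (z + σ₁ • (A φ - u)) (A v - h) + (y + σ₂ * (ℓ φ - 1)) * ℓ v by linarith
  refine le_of_forall_mul_le_mul_add_sq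
    (q := σ₁ / 2 * ‖A v - h‖ ^ 2 + σ₂ / 2 * ℓ v ^ 2) fun t ht ht1 => ?_
  have h1 := hg (WithLp.toLp 2 (φ + t • v, u + t • h))
  have h2 : (WithLp.toLp 2 (φ + t • v, u + t • h) : WithLp 2 (E × U)) - WithLp.toLp 2 (φ, u)
      = t • WithLp.toLp 2 (v, h) := by
    rw [← WithLp.toLp_sub, ← WithLp.toLp_smul]
    congr 1
    simp
  rw [h2, real_inner_smul_right, hF, hF] at h1
  have h3 : s (u + t • h) ≤ s u + t * (s (u + h) - s u) := by
    have := hs.2 (Set.mem_univ u) (Set.mem_univ (u + h)) (sub_nonneg.2 ht1) ht.le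
      (sub_add_cancel 1 t)
    have h4 : (1 - t) • u + t • (u + h) = u + t • h := by module
    rw [h4] at this
    simp only [smul_eq_mul] at this
    linarith
  have h4 : A (φ + t • v) - (u + t • h) = (A φ - u) + t • (A v - h) := by
    rw [map_add, map_smul]; module
  have h5 : ℓ (φ + t • v) - 1 = (ℓ φ - 1) + t * ℓ v := by
    rw [map_add, map_smul, smul_eq_mul]; ring
  simp only [WithLp.toLp_fst, WithLp.toLp_snd, h4, h5, sq_abs] at h1
  rw [norm_add_sq_real, norm_smul, inner_add_right, real_inner_smul_right,
    real_inner_smul_right, Real.norm_of_nonneg ht.le] at h1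
  rw [inner_add_left, real_inner_smul_left]
  linarith

/-- Strong duality: at a minimizer of `s (A φ)` on the hyperplane `ℓ φ = 1` there is a Lagrange
multiplier `(zo, yo)`. It comes from separating the strict epigraph of `s` from the affine set of
the points `(A φ, s (A φo))` with `ℓ φ = 1`. -/
theorem exists_multiplier [CompleteSpace U] {s : U → ℝ} (hs : ConvexOn ℝ Set.univ s)
    (hsc : Continuous s) (A : E →ₗ[ℝ] U) (ℓ : E →ₗ[ℝ] ℝ) {φo : E} (hφo : ℓ φo = 1)
    (hmin : ∀ φ, ℓ φ = 1 → s (A φo) ≤ s (A φ)) :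
    ∃ (zo : U) (yo : ℝ), ∀ φ u,
      s (A φo) ≤ s u + inner ℝ zo (A φ - u) + yo * (ℓ φ - 1) := by
  have hΩ : Convex ℝ {x : U × ℝ | s x.1 < x.2} := by
    simpa using hs.convex_strict_epigraph
  have hΩo : IsOpen {x : U × ℝ | s x.1 < x.2} :=
    isOpen_lt (hsc.comp continuous_fst) continuous_snd
  have hT : Convex ℝ {x : U × ℝ | ∃ φ, ℓ φ = 1 ∧ x = (A φ, s (A φo))} := by
    rintro _ ⟨φ, hφ, rfl⟩ _ ⟨ψ, hψ, rfl⟩ a b _ _ hab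
    refine ⟨a • φ + b • ψ, ?_, ?_⟩
    · simp [hφ, hψ, hab]
    · simp [← add_mul, hab]
  have hdisj : Disjoint {x : U × ℝ | s x.1 < x.2}
      {x : U × ℝ | ∃ φ, ℓ φ = 1 ∧ x = (A φ, s (A φo))} := by
    rw [Set.disjoint_left]
    rintro _ h ⟨φ, hφ, rfl⟩
    exact (hmin φ hφ).not_gt h
  obtain ⟨f, γ, hfΩ, hfT⟩ := geometric_hahn_banach_open hΩ hΩo hT hdisj
  have hsplit : ∀ u t, f (u, t) = f (u, 0) + t * f (0, 1) := fun u t => by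
    rw [← smul_eq_mul, ← map_smul, ← map_add]
    simp
  set β := f (0, 1) with hβ
  have hβneg : β < 0 := by
    have h1 := hfΩ (A φo, s (A φo) + 1) (by simp)
    have h2 := hfT (A φo, s (A φo)) ⟨φo, hφo, rfl⟩
    rw [hsplit] at h1 h2
    linarith
  -- The separating functional, rescaled so that its last component is `-1`, is `(ζ, -1)`.
  set ζ : U := (InnerProductSpace.toDual ℝ U).symm
    ((-β)⁻¹ • f.comp (ContinuousLinearMap.inl ℝ U ℝ)) with hζ
  have hζf : ∀ u, inner ℝ ζ u = (-β)⁻¹ * f (u, 0) := fun u => by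
    rw [hζ, InnerProductSpace.toDual_symm_apply]
    simp
  have key : ∀ φ u, ℓ φ = 1 → inner ℝ ζ u - s u ≤ inner ℝ ζ (A φ) - s (A φo) := by
    intro φ u hφ
    refine le_of_forall_pos_le_add fun δ hδ => ?_
    have h1 := (hfΩ (u, s u + δ) (by simpa using hδ)).le.trans (hfT _ ⟨φ, hφ, rfl⟩)
    rw [hsplit, hsplit (A φ)] at h1
    have h2 := mul_le_mul_of_nonneg_left h1 (inv_pos.2 (neg_pos.2 hβneg)).le
    have h3 : (-β)⁻¹ * β = -1 := by
      rw [inv_neg, neg_mul, inv_mul_cancel₀ hβneg.ne]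
    have h4 : ∀ x t : ℝ, (-β)⁻¹ * (x + t * β) = (-β)⁻¹ * x - t := fun x t => by
      rw [mul_add, mul_left_comm, h3]; ring
    rw [h4, h4, ← hζf, ← hζf] at h2
    linarith
  -- A linear functional bounded below on the hyperplane `ℓ = 1` is a multiple of `ℓ`.
  have hker : ∀ v, ℓ v = 0 → inner ℝ ζ (A v) = 0 := by
    intro v hv
    by_contra hne
    have h1 := key (φo + ((-1) / inner ℝ ζ (A v)) • v) (A φo) (by simp [hφo, hv])
    rw [map_add, map_smul, inner_add_right, real_inner_smul_right, div_mul_cancel₀ _ hne] at h1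
    linarith
  refine ⟨ζ, -inner ℝ ζ (A φo), fun φ u => ?_⟩
  have h1 := hker (φ - ℓ φ • φo) (by simp [hφo])
  rw [map_sub, map_smul, inner_sub_right, real_inner_smul_right] at h1
  rw [inner_sub_right]
  linarith [key φo u hφo]

end Convex

/-! ### Convergence to a set -/

/-- By compactness, every subsequence has a further subsequence converging to a point of `S`. -/
theorem tendsto_infDist_of_subseq {X : Type*} [MetricSpace X] [ProperSpace X] {S : Set X}
    {x : ℕ → X} (hx : Bornology.IsBounded (Set.range x))
    (h : ∀ (n : ℕ → ℕ) (l : X), StrictMono n → Tendsto (x ∘ n) atTop (𝓝 l) → l ∈ S) :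
    Tendsto (fun k => Metric.infDist (x k) S) atTop (𝓝 0) := by
  refine tendsto_of_subseq_tendsto fun n hn => ?_
  obtain ⟨m, hm, hnm⟩ := strictMono_subseq_of_tendsto_atTop hn
  obtain ⟨l, -, q, hq, hl⟩ := tendsto_subseq_of_bounded hx
    (x := x ∘ n ∘ m) (fun k => Set.mem_range_self _)
  have hlS : l ∈ S := h (n ∘ m ∘ q) l (hnm.comp hq) hl
  refine ⟨m ∘ q, ?_⟩
  have := ((Metric.continuous_infDist_pt S).tendsto l).comp hl
  rwa [Metric.infDist_zero_of_mem hlS] at this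

/-! ### Potentials and the graph gradient -/

section Potentials

variable {V : Type*} [Fintype V]

/-- The pairing `φ ↦ φᵀ (μ - ν)` as a linear functional. -/
def pairingₗ (μ ν : V → ℝ) : EuclideanSpace ℝ V →ₗ[ℝ] ℝ where
  toFun := pairing μ ν
  map_add' φ ψ := by simp [pairing, add_mul, Finset.sum_add_distrib]
  map_smul' a φ := by simp [pairing, Finset.mul_sum, mul_assoc]

@[simp]
theorem pairingₗ_apply (μ ν : V → ℝ) (φ : EuclideanSpace ℝ V) :
    pairingₗ μ ν φ = pairing μ ν φ := rfl

theorem continuous_pairing (μ ν : V → ℝ) : Continuous (pairing μ ν) :=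
  (pairingₗ μ ν).continuous_of_finiteDimensional

theorem continuous_sum_apply : Continuous fun φ : EuclideanSpace ℝ V => ∑ i, φ i := by fun_prop

theorem pairing_center {μ ν : V → ℝ} (hμ : μ ∈ stdSimplex ℝ V) (hν : ν ∈ stdSimplex ℝ V)
    (φ : EuclideanSpace ℝ V) : pairing μ ν (center φ) = pairing μ ν φ := by
  simp [pairing, center, sub_mul, Finset.sum_sub_distrib, ← Finset.mul_sum, hμ.2, hν.2]

theorem sum_center [Nonempty V] (φ : EuclideanSpace ℝ V) : ∑ i, center φ i = 0 := by
  simp [center, Finset.sum_sub_distrib, mul_div_cancel₀]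

theorem exists_pairing_eq_one {μ ν : V → ℝ} (hμν : μ ≠ ν) :
    ∃ φ : EuclideanSpace ℝ V, pairing μ ν φ = 1 := by
  have hpos : ∑ i, (μ i - ν i) * (μ i - ν i) ≠ 0 := fun h => by
    rw [Finset.sum_eq_zero_iff_of_nonneg fun i _ => mul_self_nonneg _] at h
    exact hμν (funext fun i => sub_eq_zero.1 (mul_self_eq_zero.1 (h i (Finset.mem_univ i))))
  let ψ : EuclideanSpace ℝ V := WithLp.toLp 2 fun i => μ i - ν i
  refine ⟨(∑ i, (μ i - ν i) * (μ i - ν i))⁻¹ • ψ, ?_⟩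
  rw [← pairingₗ_apply, map_smul, smul_eq_mul]
  exact inv_mul_cancel₀ hpos

/-- A connected graph without edges has a single vertex, which carries only one probability
vector. -/
theorem nonempty_dart {G : SimpleGraph V} {μ ν : V → ℝ} (hG : G.Connected)
    (hμ : μ ∈ stdSimplex ℝ V) (hν : ν ∈ stdSimplex ℝ V) (hμν : μ ≠ ν) : Nonempty G.Dart := by
  by_contra h
  have := not_nonempty_iff.1 h
  refine hμν (funext fun i => ?_)
  have hsingle : ∀ j, j = i := fun j => by
    obtain ⟨W⟩ := hG.preconnected j i
    cases W with
    | nil => rfl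
    | cons h' _ => exact isEmptyElim (⟨(_, _), h'⟩ : G.Dart)
  have hsum : ∀ f : V → ℝ, ∑ j, f j = f i := fun f =>
    Fintype.sum_eq_single i fun j hj => absurd (hsingle j) hj
  rw [← hsum μ, ← hsum ν, hμ.2, hν.2]

end Potentials

section Graph

variable {V : Type*} [Fintype V] [DecidableEq V] (G : SimpleGraph V) [DecidableRel G.Adj]

@[simp]
theorem grad_apply (φ : EuclideanSpace ℝ V) (d : G.Dart) : grad G φ d = φ d.fst - φ d.snd := by
  simp [grad, incidence, Matrix.mulVec, dotProduct, sub_mul, Finset.sum_sub_distrib]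

/-- The graph gradient `φ ↦ Bᵀ φ` as a linear map. -/
def gradₗ : EuclideanSpace ℝ V →ₗ[ℝ] EuclideanSpace ℝ G.Dart where
  toFun := grad G
  map_add' φ ψ := by ext d; simp; ring
  map_smul' a φ := by ext d; simp; ring

@[simp]
theorem gradₗ_apply (φ : EuclideanSpace ℝ V) : gradₗ G φ = grad G φ := rfl

theorem continuous_grad : Continuous (grad G) := (gradₗ G).continuous_of_finiteDimensional

@[simp]
theorem grad_center (φ : EuclideanSpace ℝ V) : grad G (center φ) = grad G φ := by
  ext d; simp [center]

variable {G}

/-- On a connected graph the gradient determines a potential up to a constant. -/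
theorem eq_of_grad_eq (hG : G.Connected) {φ ψ : EuclideanSpace ℝ V}
    (hgrad : grad G φ = grad G ψ) (hsum : ∑ i, φ i = ∑ i, ψ i) : φ = ψ := by
  have hadj : ∀ i j, G.Adj i j → φ i - ψ i = φ j - ψ j := fun i j hij => by
    have := congrArg (fun x => x ⟨(i, j), hij⟩) hgrad
    simp only [grad_apply] at this
    linarith
  have hconst : ∀ i j, φ i - ψ i = φ j - ψ j := fun i j => by
    obtain ⟨W⟩ := hG.preconnected i j
    induction W with
    | nil => rfl
    | cons h _ ih => exact (hadj _ _ h).trans ih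
  ext i
  have h1 : ∑ j, (φ j - ψ j) = 0 := by rw [Finset.sum_sub_distrib, hsum, sub_self]
  rw [Finset.sum_congr rfl fun j _ => hconst j i] at h1
  have : Nonempty V := ⟨i⟩
  simp only [Finset.sum_const, Finset.card_univ, nsmul_eq_mul, mul_eq_zero, Nat.cast_eq_zero,
    Fintype.card_ne_zero, false_or] at h1
  linarith

/-- A Poincaré inequality: on a connected graph the gradient controls the centered potential. -/
theorem exists_norm_center_le (hG : G.Connected) :
    ∃ κ : ℝ, 0 ≤ κ ∧ ∀ φ : EuclideanSpace ℝ V, ‖center φ‖ ≤ κ * ‖grad G φ‖ := by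
  have := hG.nonempty
  let sumₗ : EuclideanSpace ℝ V →ₗ[ℝ] ℝ :=
    { toFun := fun φ => ∑ i, φ i
      map_add' := fun φ ψ => by simp [Finset.sum_add_distrib]
      map_smul' := fun a φ => by simp [Finset.mul_sum] }
  have hker : LinearMap.ker ((gradₗ G).prod sumₗ) = ⊥ := by
    refine LinearMap.ker_eq_bot.2 fun φ ψ h => ?_
    obtain ⟨h1, h2⟩ := Prod.ext_iff.1 h
    exact eq_of_grad_eq hG h1 h2
  obtain ⟨K, -, hK⟩ := ((gradₗ G).prod sumₗ).exists_antilipschitzWith hker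
  refine ⟨K, K.2, fun φ => ?_⟩
  have h1 := hK.le_mul_dist (center φ) 0
  have h2 : sumₗ (center φ) = 0 := sum_center φ
  rw [map_zero, dist_zero_right, dist_zero_right, LinearMap.prod_apply, Function.prod_apply, h2,
    gradₗ_apply, grad_center] at h1
  simpa using h1

end Graph

/-! ### The objective -/

section Energy

theorem abs_combo_rpow_le {q : ℝ} (hq : 1 ≤ q) (x y : ℝ) {a b : ℝ} (ha : 0 ≤ a) (hb : 0 ≤ b)
    (hab : a + b = 1) : |a * x + b * y| ^ q ≤ a * |x| ^ q + b * |y| ^ q := by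
  have h1 : |a * x + b * y| ≤ a * |x| + b * |y| := by
    simpa [abs_mul, abs_of_nonneg ha, abs_of_nonneg hb] using abs_add_le (a * x) (b * y)
  exact (Real.rpow_le_rpow (abs_nonneg _) h1 (by linarith)).trans
    ((convexOn_rpow hq).2 (abs_nonneg x) (abs_nonneg y) ha hb hab)

theorem abs_midpoint_rpow_lt {q : ℝ} (hq : 1 < q) {x y : ℝ} (hxy : x ≠ y) :
    |1 / 2 * x + 1 / 2 * y| ^ q < 1 / 2 * |x| ^ q + 1 / 2 * |y| ^ q := by
  have hq0 : 0 < q := by linarith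
  by_cases h : |x| = |y|
  · obtain rfl : x = -y := (abs_eq_abs.1 h).resolve_left hxy
    have hy : y ≠ 0 := fun h0 => hxy (by simp [h0])
    have : 1 / 2 * -y + 1 / 2 * y = 0 := by ring
    rw [this, abs_zero, Real.zero_rpow hq0.ne', abs_neg]
    have := Real.rpow_pos_of_pos (abs_pos.2 hy) q
    linarith
  · have h1 : |1 / 2 * x + 1 / 2 * y| ≤ 1 / 2 * |x| + 1 / 2 * |y| := by
      simpa [abs_mul] using abs_add_le (1 / 2 * x) (1 / 2 * y)
    exact (Real.rpow_le_rpow (abs_nonneg _) h1 hq0.le).trans_lt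
      ((strictConvexOn_rpow hq).2 (abs_nonneg x) (abs_nonneg y) h (by norm_num) (by norm_num)
        (by norm_num))

variable {V : Type*} [Fintype V] {G : SimpleGraph V} [DecidableRel G.Adj]
  {w : V → V → ℝ} {p : ℝ≥0∞}

theorem one_le_toReal_of_ne_top (hp : 1 ≤ p) (hp' : p ≠ ⊤) : 1 ≤ p.toReal := by
  simpa using ENNReal.toReal_mono hp' hp

theorem convexOn_energy [Nonempty G.Dart] (hw : ∀ i j, G.Adj i j → 0 < w i j) (hp : 1 ≤ p) :
    ConvexOn ℝ Set.univ (energy G w p) := by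
  refine ⟨convex_univ, fun u _ v _ a b ha hb hab => ?_⟩
  by_cases hpt : p = ⊤
  · simp only [energy, hpt, if_true]
    refine ciSup_le fun d => ?_
    have hwd := (hw _ _ d.adj).le
    have hu := mul_le_mul_of_nonneg_left
      (le_ciSup (Finite.bddAbove_range fun d : G.Dart => w d.fst d.snd * |u d|) d) ha
    have hv := mul_le_mul_of_nonneg_left
      (le_ciSup (Finite.bddAbove_range fun d : G.Dart => w d.fst d.snd * |v d|) d) hb
    have h1 : |a * u d + b * v d| ≤ a * |u d| + b * |v d| := by
      simpa [abs_mul, abs_of_nonneg ha, abs_of_nonneg hb] using abs_add_le (a * u d) (b * v d)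
    have h2 := mul_le_mul_of_nonneg_left h1 hwd
    simp only [PiLp.add_apply, PiLp.smul_apply, smul_eq_mul]
    linarith
  · simp only [energy, hpt, if_false, smul_eq_mul]
    rw [mul_left_comm, mul_left_comm b, ← mul_add, Finset.mul_sum _ _ a, Finset.mul_sum _ _ b,
      ← Finset.sum_add_distrib]
    refine mul_le_mul_of_nonneg_left (Finset.sum_le_sum fun d _ => ?_) (by norm_num)
    have := mul_le_mul_of_nonneg_left
      (abs_combo_rpow_le (one_le_toReal_of_ne_top hp hpt) (u d) (v d) ha hb hab)
      (hw _ _ d.adj).le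
    simp only [PiLp.add_apply, PiLp.smul_apply, smul_eq_mul]
    linarith

theorem continuous_energy [Nonempty G.Dart] (hw : ∀ i j, G.Adj i j → 0 < w i j) (hp : 1 ≤ p) :
    Continuous (energy G w p) :=
  continuousOn_univ.1 ((convexOn_energy hw hp).continuousOn isOpen_univ)

theorem norm_le_sum_abs {ι : Type*} [Fintype ι] (u : EuclideanSpace ℝ ι) :
    ‖u‖ ≤ ∑ d, |u d| := by
  rw [EuclideanSpace.norm_eq]
  refine Real.sqrt_le_iff.2 ⟨Finset.sum_nonneg fun _ _ => abs_nonneg _, ?_⟩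
  exact Finset.sum_sq_le_sq_sum_of_nonneg fun d _ => abs_nonneg (u d)

/-- The objective grows at least linearly. For finite `p` this rests on `|t| - 1 ≤ |t| ^ p`, and for
`p = ∞` on the maximum being at least the average. -/
theorem exists_linear_growth_energy [Nonempty G.Dart] (hw : ∀ i j, G.Adj i j → 0 < w i j)
    (hp : 1 ≤ p) :
    ∃ c C : ℝ, 0 < c ∧ ∀ u : EuclideanSpace ℝ G.Dart, c * ‖u‖ - C ≤ energy G w p u := by
  obtain ⟨d₀, hd₀⟩ := Finite.exists_min fun d : G.Dart => w d.fst d.snd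
  set m := w d₀.fst d₀.snd
  have hm : 0 < m := hw _ _ d₀.adj
  by_cases hpt : p = ⊤
  · have hcard : (0 : ℝ) < Fintype.card G.Dart := by exact_mod_cast Fintype.card_pos
    refine ⟨m / Fintype.card G.Dart, 0, by positivity, fun u => ?_⟩
    simp only [energy, hpt, if_true, sub_zero]
    rw [div_mul_eq_mul_div, div_le_iff₀ hcard]
    calc m * ‖u‖ ≤ m * ∑ d, |u d| := by gcongr; exact norm_le_sum_abs u
      _ = ∑ d, m * |u d| := Finset.mul_sum ..
      _ ≤ ∑ _d : G.Dart, ⨆ d : G.Dart, w d.fst d.snd * |u d| :=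
        Finset.sum_le_sum fun d _ => (mul_le_mul_of_nonneg_right (hd₀ d) (abs_nonneg _)).trans
          (le_ciSup (Finite.bddAbove_range fun d : G.Dart => w d.fst d.snd * |u d|) d)
      _ = _ := by simp [mul_comm]
  · have hq := one_le_toReal_of_ne_top hp hpt
    refine ⟨1 / 2 * m, 1 / 2 * (m * Fintype.card G.Dart), by positivity, fun u => ?_⟩
    simp only [energy, hpt, if_false]
    have hterm : ∀ d : G.Dart, m * (|u d| - 1) ≤ w d.fst d.snd * |u d| ^ p.toReal := fun d => by
      have hpow : 0 ≤ |u d| ^ p.toReal := by positivity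
      have h1 : |u d| - 1 ≤ |u d| ^ p.toReal := by
        rcases le_total 1 |u d| with h | h
        · have := Real.rpow_le_rpow_of_exponent_le h hq
          rw [Real.rpow_one] at this
          linarith
        · linarith
      exact (mul_le_mul_of_nonneg_left h1 hm.le).trans (mul_le_mul_of_nonneg_right (hd₀ d) hpow)
    calc 1 / 2 * m * ‖u‖ - 1 / 2 * (m * Fintype.card G.Dart)
        ≤ 1 / 2 * m * ∑ d, |u d| - 1 / 2 * (m * Fintype.card G.Dart) := by
          gcongr; exact norm_le_sum_abs u
      _ = 1 / 2 * ∑ d, m * (|u d| - 1) := by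
          rw [← Finset.mul_sum, Finset.sum_sub_distrib]; simp; ring
      _ ≤ _ := mul_le_mul_of_nonneg_left (Finset.sum_le_sum fun d _ => hterm d) (by norm_num)

/-- Strict convexity of the objective for `1 < p < ∞`, at midpoints. -/
theorem energy_midpoint_lt (hw : ∀ i j, G.Adj i j → 0 < w i j) (hp : 1 < p) (hpt : p < ⊤)
    {u v : EuclideanSpace ℝ G.Dart} (huv : u ≠ v) :
    energy G w p ((1 / 2 : ℝ) • u + (1 / 2 : ℝ) • v)
      < 1 / 2 * energy G w p u + 1 / 2 * energy G w p v := by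
  have hq : 1 < p.toReal := by simpa using (ENNReal.toReal_lt_toReal (by simp) hpt.ne).2 hp
  obtain ⟨d, hd⟩ : ∃ d, u d ≠ v d := by
    by_contra! h
    exact huv (PiLp.ext h)
  have hsum : ∑ d : G.Dart, w d.fst d.snd *
      |((1 / 2 : ℝ) • u + (1 / 2 : ℝ) • v) d| ^ p.toReal
      < ∑ d : G.Dart, (1 / 2 * (w d.fst d.snd * |u d| ^ p.toReal)
        + 1 / 2 * (w d.fst d.snd * |v d| ^ p.toReal)) := by
    simp only [PiLp.add_apply, PiLp.smul_apply, smul_eq_mul]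
    refine Finset.sum_lt_sum (fun d _ => ?_) ⟨d, Finset.mem_univ d, ?_⟩
    · have := mul_le_mul_of_nonneg_left (abs_combo_rpow_le hq.le (u d) (v d) (a := 1 / 2)
        (b := 1 / 2) (by norm_num) (by norm_num) (by norm_num)) (hw _ _ d.adj).le
      linarith
    · have := mul_lt_mul_of_pos_left (abs_midpoint_rpow_lt hq hd) (hw _ _ d.adj)
      linarith
  rw [Finset.sum_add_distrib, ← Finset.mul_sum, ← Finset.mul_sum] at hsum
  simp only [energy, hpt.ne, if_false]
  linarith

end Energy

/-! ### Optimal solutions -/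

section Solutions

variable {V : Type*} [Fintype V] [DecidableEq V] {G : SimpleGraph V} [DecidableRel G.Adj]
  {w : V → V → ℝ} {p : ℝ≥0∞} {μ ν : V → ℝ}

/-- The constraint `Bᵀ φ - u = 0` eliminates `u`. -/
theorem mem_centeredSolutions_iff {φ : EuclideanSpace ℝ V} :
    φ ∈ centeredSolutions G w p μ ν ↔ ∑ i, φ i = 0 ∧ pairing μ ν φ = 1 ∧
      ∀ ψ, pairing μ ν ψ = 1 → energy G w p (grad G φ) ≤ energy G w p (grad G ψ) := by
  constructor
  · rintro ⟨h0, u, ⟨h1, h2⟩, h3⟩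
    obtain rfl := sub_eq_zero.1 h2
    exact ⟨h0, h1, fun ψ hψ => h3 ψ _ ⟨hψ, sub_self _⟩⟩
  · rintro ⟨h0, h1, h2⟩
    refine ⟨h0, grad G φ, ⟨h1, sub_self _⟩, ?_⟩
    rintro ψ u ⟨hψ, hu⟩
    obtain rfl := sub_eq_zero.1 hu
    exact h2 ψ hψ

theorem centeredSolutions_nonempty (hG : G.Connected) (hw : ∀ i j, G.Adj i j → 0 < w i j)
    (hμ : μ ∈ stdSimplex ℝ V) (hν : ν ∈ stdSimplex ℝ V) (hμν : μ ≠ ν) (hp : 1 ≤ p) :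
    (centeredSolutions G w p μ ν).Nonempty := by
  have := nonempty_dart hG hμ hν hμν
  have := hG.nonempty
  obtain ⟨κ, hκ, hcenter⟩ := exists_norm_center_le hG
  obtain ⟨c, C, hc, hgrowth⟩ := exists_linear_growth_energy (p := p) hw hp
  obtain ⟨φ₀, hφ₀⟩ := exists_pairing_eq_one hμν
  set m := energy G w p (grad G φ₀) with hm
  have hcont : Continuous fun φ => energy G w p (grad G φ) :=
    (continuous_energy hw hp).comp (continuous_grad G)
  -- The centered feasible potentials in a sublevel set of the objective form a compact set.
  let T : Set (EuclideanSpace ℝ V) :=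
    {φ | ∑ i, φ i = 0 ∧ pairing μ ν φ = 1} ∩ {φ | energy G w p (grad G φ) ≤ m}
  have hTclosed : IsClosed T :=
    ((isClosed_eq continuous_sum_apply continuous_const).inter
      (isClosed_eq (continuous_pairing μ ν) continuous_const)).inter
      (isClosed_le hcont continuous_const)
  have hTbdd : T ⊆ Metric.closedBall 0 (κ * ((m + C) / c)) := by
    rintro φ ⟨⟨h0, -⟩, h2⟩
    have hφ : center φ = φ := by ext i; simp [center, h0]
    rw [mem_closedBall_zero_iff, ← hφ]
    refine (hcenter φ).trans (mul_le_mul_of_nonneg_left ((le_div_iff₀ hc).2 ?_) hκ)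
    have h2 : energy G w p (grad G φ) ≤ m := h2
    linarith [hgrowth (grad G φ)]
  have hTcompact : IsCompact T :=
    (isCompact_closedBall _ _).of_isClosed_subset hTclosed hTbdd
  have hTne : T.Nonempty := by
    refine ⟨center φ₀, ⟨sum_center φ₀, by rw [pairing_center hμ hν, hφ₀]⟩, ?_⟩
    simp [hm]
  obtain ⟨φ, hφT, hφ⟩ := hTcompact.exists_isMinOn hTne hcont.continuousOn
  refine ⟨φ, mem_centeredSolutions_iff.2 ⟨hφT.1.1, hφT.1.2, fun ψ hψ => ?_⟩⟩
  rcases le_total (energy G w p (grad G ψ)) m with h | h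
  · have hψT : center ψ ∈ T :=
      ⟨⟨sum_center ψ, by rw [pairing_center hμ hν, hψ]⟩, by simpa using h⟩
    simpa using hφ hψT
  · exact le_trans hφT.2 h

theorem centeredSolutions_subsingleton (hG : G.Connected) (hw : ∀ i j, G.Adj i j → 0 < w i j)
    (hp : 1 < p) (hpt : p < ⊤) : (centeredSolutions G w p μ ν).Subsingleton := by
  intro φ hφ ψ hψ
  rw [mem_centeredSolutions_iff] at hφ hψ
  by_contra hne
  have hgrad : grad G φ ≠ grad G ψ := fun h => hne (eq_of_grad_eq hG h (hφ.1.trans hψ.1.symm))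
  have hlt := energy_midpoint_lt (w := w) hw hp hpt hgrad
  have hmid : grad G ((1 / 2 : ℝ) • φ + (1 / 2 : ℝ) • ψ)
      = (1 / 2 : ℝ) • grad G φ + (1 / 2 : ℝ) • grad G ψ := by
    simp only [← gradₗ_apply, map_add, map_smul]
  have hfeas : pairing μ ν ((1 / 2 : ℝ) • φ + (1 / 2 : ℝ) • ψ) = 1 := by
    have h1 := hφ.2.1
    have h2 := hψ.2.1
    simp only [← pairingₗ_apply] at h1 h2 ⊢
    rw [map_add, map_smul, map_smul, h1, h2]
    norm_num
  have h1 := hφ.2.2 _ hfeas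
  have h2 := hψ.2.2 _ hfeas
  rw [hmid] at h1 h2
  linarith

end Solutions

/-! ### The inexact minimization step and convergence -/

section Algorithm

variable {V : Type*} [Fintype V] [DecidableEq V] {G : SimpleGraph V} [DecidableRel G.Adj]
  {w : V → V → ℝ} {p : ℝ≥0∞} {μ ν : V → ℝ}

/-- Comparison of an approximate minimizer `(φ, u)` of the augmented Lagrangian with a feasible
potential `φo`. The subgradient inequality is tested in the direction `(center (φo - φ), Bᵀ φo - u)`
rather than `(φo - φ, Bᵀ φo - u)`: the discarded constant does not change any term, and the
remaining direction is controlled by `u` and the residual through the Poincaré constant `κ`. -/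
theorem energy_add_inner_le_of_stationary [Nonempty G.Dart]
    (hw : ∀ i j, G.Adj i j → 0 < w i j) (hp : 1 ≤ p) (hμ : μ ∈ stdSimplex ℝ V)
    (hν : ν ∈ stdSimplex ℝ V) {κ : ℝ} (hκ : 0 ≤ κ)
    (hcenter : ∀ φ : EuclideanSpace ℝ V, ‖center φ‖ ≤ κ * ‖grad G φ‖)
    {σ₁ σ₂ y ε : ℝ} {z u : EuclideanSpace ℝ G.Dart} {φ φo : EuclideanSpace ℝ V}
    {g : WithLp 2 (EuclideanSpace ℝ V × EuclideanSpace ℝ G.Dart)}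
    (hg : g ∈ subdifferential (augLagrangian G w p μ ν σ₁ σ₂ y z) (WithLp.toLp 2 (φ, u)))
    (hgε : ‖g‖ ≤ ε) (hφo : pairing μ ν φo = 1) :
    energy G w p u + inner ℝ (z + σ₁ • (grad G φ - u)) (grad G φ - u)
        + (y + σ₂ * (pairing μ ν φ - 1)) * (pairing μ ν φ - 1)
      ≤ energy G w p (grad G φo)
        + ε * ((1 + κ) * ‖u - grad G φo‖ + κ * ‖grad G φ - u‖) := by
  set v := center (φo - φ) with hv
  set h := grad G φo - u with hh
  have hgv : grad G v = grad G φo - grad G φ := by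
    rw [hv, grad_center, ← gradₗ_apply, map_sub]; rfl
  have hpv : pairing μ ν v = 1 - pairing μ ν φ := by
    rw [hv, pairing_center hμ hν, ← pairingₗ_apply, map_sub, pairingₗ_apply, hφo,
      pairingₗ_apply]
  have h1 := add_inner_le_of_mem_subdifferential (convexOn_energy hw hp) (gradₗ G)
    (pairingₗ μ ν) (fun x => rfl) hg v h
  have h2 : grad G v - h = -(grad G φ - u) := by rw [hgv, hh]; abel
  simp only [gradₗ_apply, pairingₗ_apply, h2, hpv, inner_neg_right] at h1
  rw [hh, add_sub_cancel] at h1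
  have hnv : ‖v‖ ≤ κ * (‖u - grad G φo‖ + ‖grad G φ - u‖) := by
    refine (hcenter _).trans (mul_le_mul_of_nonneg_left ?_ hκ)
    rw [← grad_center, ← hv, hgv, norm_sub_rev, add_comm]
    exact norm_sub_le_norm_sub_add_norm_sub _ _ _
  have hnorm : ‖(WithLp.toLp 2 (v, h) : WithLp 2 (_ × _))‖ ≤ ‖v‖ + ‖h‖ := by
    rw [WithLp.prod_norm_eq_of_L2]
    exact Real.sqrt_le_iff.2 ⟨by positivity, by
      simp only [WithLp.toLp_fst, WithLp.toLp_snd]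
      nlinarith [mul_nonneg (norm_nonneg v) (norm_nonneg h)]⟩
  have h3 : -(ε * ((1 + κ) * ‖u - grad G φo‖ + κ * ‖grad G φ - u‖))
      ≤ inner ℝ g (WithLp.toLp 2 (v, h)) := by
    refine (abs_le.1 ((abs_real_inner_le_norm _ _).trans
      (mul_le_mul hgε (hnorm.trans ?_) (norm_nonneg _) ((norm_nonneg g).trans hgε)))).1
    rw [hh, norm_sub_rev (grad G φo) u]
    linarith
  linarith

/-- The summable slack `(1 / 2) ^ k` turns the bound on the distance to the subdifferential into a
bound on some subgradient, so that the distance need not be attained. -/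
theorem exists_approx_stationary {σ₁ σ₂ ε : ℕ → ℝ} {φ : ℕ → EuclideanSpace ℝ V}
    {u z : ℕ → EuclideanSpace ℝ G.Dart} {y : ℕ → ℝ} (hε : ∀ k, 0 ≤ ε k)
    (hseq : IsSSNALSequence G w p μ ν σ₁ σ₂ ε φ u z y) (k : ℕ) :
    ∃ g ∈ subdifferential (augLagrangian G w p μ ν (σ₁ k) (σ₂ k) (y k) (z k))
      (WithLp.toLp 2 (φ (k + 1), u (k + 1))), ‖g‖ ≤ ε k + (1 / 2) ^ k := by
  have h1 : ε k / max 1 (√(min (σ₁ k) (σ₂ k))) ≤ ε k :=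
    div_le_self (hε k) (le_max_left _ _)
  have hpos : (0 : ℝ) < (1 / 2) ^ k := by positivity
  have h2 : ENNReal.ofReal (ε k / max 1 (√(min (σ₁ k) (σ₂ k))))
      < ENNReal.ofReal (ε k + (1 / 2) ^ k) :=
    (ENNReal.ofReal_lt_ofReal_iff (by linarith [hε k])).2 (by linarith)
  obtain ⟨g, hg, hlt⟩ := Metric.infEDist_lt_iff.1 ((hseq.stopping k).trans_lt h2)
  refine ⟨g, hg, ?_⟩
  rw [edist_dist, dist_zero_left] at hlt
  exact ((ENNReal.ofReal_lt_ofReal_iff (by linarith [hε k])).1 hlt).le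

end Algorithm

end PConductance

theorem mainTheorem7 {V : Type*} [Fintype V] [DecidableEq V]
    (G : SimpleGraph V) [DecidableRel G.Adj] (hG : G.Connected)
    (w : V → V → ℝ) (hw_symm : ∀ i j, w i j = w j i) (hw_pos : ∀ i j, G.Adj i j → 0 < w i j)
    (μ ν : V → ℝ) (hμ : μ ∈ stdSimplex ℝ V) (hν : ν ∈ stdSimplex ℝ V) (hμν : μ ≠ ν)
    (p : ℝ≥0∞) (hp : 1 ≤ p)
    (σ₁ σ₂ ε : ℕ → ℝ)
    (hσ₁_pos : ∀ k, 0 < σ₁ k) (hσ₁_mono : Monotone σ₁)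
    (hσ₂_pos : ∀ k, 0 < σ₂ k) (hσ₂_mono : Monotone σ₂)
    (hε_nonneg : ∀ k, 0 ≤ ε k) (hε_sum : Summable ε)
    (φ : ℕ → EuclideanSpace ℝ V) (u z : ℕ → EuclideanSpace ℝ G.Dart) (y : ℕ → ℝ)
    (hseq : PConductance.IsSSNALSequence G w p μ ν σ₁ σ₂ ε φ u z y) :
    -- the iterates, modulo constants, are bounded
    Bornology.IsBounded (Set.range fun k => PConductance.center (φ k)) ∧
    -- they approach the set of optimal solutions, which is not empty
    (PConductance.centeredSolutions G w p μ ν).Nonempty ∧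
    Tendsto (fun k => Metric.infDist (PConductance.center (φ k))
      (PConductance.centeredSolutions G w p μ ν)) atTop (𝓝 0) ∧
    -- for `1 < p < ∞` the optimal solution is unique and the iterates converge to it
    (1 < p → p < ⊤ → ∃ φ' : EuclideanSpace ℝ V,
      PConductance.centeredSolutions G w p μ ν = {φ'} ∧
      Tendsto (fun k => PConductance.center (φ k)) atTop (𝓝 φ')) ∧
    -- for `p = 1` and `p = ∞` as well, they converge to the optimal solution if it is unique
    (∀ φ' : EuclideanSpace ℝ V, PConductance.centeredSolutions G w p μ ν = {φ'} →
      Tendsto (fun k => PConductance.center (φ k)) atTop (𝓝 φ')) ∧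
    -- the residuals tend to zero
    Tendsto (fun k => ‖PConductance.grad G (φ k) - u k‖) atTop (𝓝 0) ∧
    Tendsto (fun k => |PConductance.pairing μ ν (φ k) - 1|) atTop (𝓝 0) := by
  open PConductance in
  have := nonempty_dart hG hμ hν hμν
  have := hG.nonempty
  obtain ⟨κ, hκ, hcenter⟩ := exists_norm_center_le hG
  obtain ⟨c, C, hc, hgrowth⟩ := exists_linear_growth_energy (p := p) hw_pos hp
  have hne := centeredSolutions_nonempty hG hw_pos hμ hν hμν hp
  obtain ⟨φo, hφo⟩ := hne
  obtain ⟨-, hφo1, hφomin⟩ := mem_centeredSolutions_iff.1 hφo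
  have hscont := continuous_energy (p := p) hw_pos hp
  obtain ⟨zo, yo, hdual⟩ := exists_multiplier (convexOn_energy hw_pos hp) hscont (gradₗ G)
    (pairingₗ μ ν) hφo1 hφomin
  simp only [gradₗ_apply, pairingₗ_apply] at hdual
  obtain ⟨⟨M, hM⟩, hr, hρ, e, he, hfe⟩ := multiplier_method_estimates
    (u := fun k => u (k + 1)) (z := z) (r := fun k => grad G (φ (k + 1)) - u (k + 1)) (y := y)
    (ρ := fun k => pairing μ ν (φ (k + 1)) - 1) (f := fun k => energy G w p (u (k + 1)))
    (ε := fun k => ε k + (1 / 2) ^ k) (uo := grad G φo) (fo := energy G w p (grad G φo))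
    hκ hc hσ₁_pos hσ₁_mono hσ₂_pos hσ₂_mono
    (fun k => add_nonneg (hε_nonneg k) (by positivity)) (hε_sum.add summable_geometric_two)
    hseq.z_update hseq.y_update
    (fun k => by
      obtain ⟨g, hg, hgε⟩ := exists_approx_stationary hε_nonneg hseq k
      have := energy_add_inner_le_of_stationary hw_pos hp hμ hν hκ hcenter hg hgε hφo1
      rwa [← hseq.z_update, ← hseq.y_update] at this)
    (fun k => hdual _ _) (fun k => hgrowth _)
  have hr' : Tendsto (fun k => grad G (φ k) - u k) atTop (𝓝 0) :=
    (tendsto_add_atTop_iff_nat 1).1 hr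
  have hρ' : Tendsto (fun k => pairing μ ν (φ k) - 1) atTop (𝓝 0) :=
    (tendsto_add_atTop_iff_nat 1).1 hρ
  -- The estimates above are indexed by the step that produces `u (k + 1)`; `k - 1` undoes the shift,
  -- and its truncation at `k = 0` is irrelevant for limits.
  have he' : Tendsto (fun k => e (k - 1)) atTop (𝓝 0) :=
    (tendsto_add_atTop_iff_nat 1).1 (by simpa using he)
  have hfe' : ∀ᶠ k in atTop, energy G w p (u k) ≤ energy G w p (grad G φo) + e (k - 1) := by
    filter_upwards [(tendsto_sub_atTop_nat 1).eventually hfe, eventually_ge_atTop 1] with k hk hk1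
    rwa [Nat.sub_add_cancel hk1] at hk
  have hbdd : Bornology.IsBounded (Set.range fun k => center (φ k)) := by
    have hev : ∀ᶠ k in atTop, ‖center (φ k)‖ ≤ κ * (1 + M) := by
      filter_upwards [(tendsto_sub_atTop_nat 1).eventually hM, eventually_ge_atTop 1,
        hr'.norm.eventually_le_const (by simp : ‖(0 : EuclideanSpace ℝ G.Dart)‖ < 1)]
        with k hk hk1 hrk
      rw [Nat.sub_add_cancel hk1] at hk
      refine (hcenter _).trans (mul_le_mul_of_nonneg_left ?_ hκ)
      have := norm_add_le (grad G (φ k) - u k) (u k)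
      rw [sub_add_cancel] at this
      linarith
    obtain ⟨K, hK⟩ := eventually_atTop.1 hev
    refine (((Set.finite_Iio K).image fun k => center (φ k)).isBounded.union
      (Metric.isBounded_closedBall (x := 0) (r := κ * (1 + M)))).subset ?_
    rintro _ ⟨k, rfl⟩
    rcases lt_or_ge k K with h | h
    · exact Or.inl ⟨k, h, rfl⟩
    · exact Or.inr (mem_closedBall_zero_iff.2 (hK k h))
  have hdist : Tendsto (fun k => Metric.infDist (center (φ k)) (centeredSolutions G w p μ ν))
      atTop (𝓝 0) := by
    refine tendsto_infDist_of_subseq hbdd fun n l hn hl => ?_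
    have hn' := hn.tendsto_atTop
    have hgl : Tendsto (fun k => grad G (φ (n k))) atTop (𝓝 (grad G l)) := by
      simpa [Function.comp_def] using ((continuous_grad G).tendsto l).comp hl
    have hul : Tendsto (fun k => u (n k)) atTop (𝓝 (grad G l)) := by
      simpa using hgl.sub (hr'.comp hn')
    have hpl : Tendsto (fun k => pairing μ ν (φ (n k))) atTop (𝓝 (pairing μ ν l)) := by
      simpa [Function.comp_def, pairing_center hμ hν] using
        ((continuous_pairing μ ν).tendsto l).comp hl
    have hpl' : Tendsto (fun k => pairing μ ν (φ (n k))) atTop (𝓝 1) := by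
      simpa using (hρ'.comp hn').add_const 1
    have hle : energy G w p (grad G l) ≤ energy G w p (grad G φo) := by
      have h1 : Tendsto (fun k => energy G w p (grad G φo) + e (n k - 1)) atTop
          (𝓝 (energy G w p (grad G φo) + 0)) := (he'.comp hn').const_add _
      rw [add_zero] at h1
      exact le_of_tendsto_of_tendsto ((hscont.tendsto _).comp hul) h1 (hn'.eventually hfe')
    refine mem_centeredSolutions_iff.2 ⟨?_, tendsto_nhds_unique hpl hpl',
      fun ψ hψ => hle.trans (hφomin ψ hψ)⟩
    have h1 := (continuous_sum_apply.tendsto l).comp hl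
    simp only [Function.comp_def, sum_center] at h1
    exact tendsto_nhds_unique h1 tendsto_const_nhds
  have hconv : ∀ φ' : EuclideanSpace ℝ V, centeredSolutions G w p μ ν = {φ'} →
      Tendsto (fun k => center (φ k)) atTop (𝓝 φ') := fun φ' h => by
    rw [h] at hdist
    simpa [tendsto_iff_dist_tendsto_zero] using hdist
  refine ⟨hbdd, ⟨φo, hφo⟩, hdist, fun hp1 hpt => ?_, hconv, ?_, ?_⟩
  · have h := (centeredSolutions_subsingleton hG hw_pos hp1 hpt).eq_singleton_of_mem hφo
    exact ⟨φo, h, hconv φo h⟩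
  · simpa using hr'.norm
  · simpa using hρ'.abs
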